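/- Let $k\subset L$ be an extension of algebraically closed fields of characteristic zero with $L$ uncountable. Let $X$ be a finite type separated scheme over $k$. If $X$ is arithmetically hyperbolic over $k$ and $X_L := X\times_{\operatorname{Spec} k}\operatorname{Spec} L$ is geometrically hyperbolic over $L$, then, for every extension of algebraically closed fields $k\subset K$, the scheme $X_K := X\times_{\operatorname{Spec} k}\operatorname{Spec} K$ is arithmetically hyperbolic over $K$. Here, for an algebraically closed field $F$ of characteristic zero and a finite type separated scheme $Y$ over $F$: - $Y$ is *arithmetically hyperbolic over $F$* if there are a subring $A\subset F$ that is finitely generated as a $\mathbb{Z}$-algebra, a finite type separated $A$-scheme $\mathcal{Y}$, and an isomorphism $\mathcal{Y}\times_{\operatorname{Spec} A}\operatorname{Spec} F\cong Y$ of $F$-schemes such that, for every subring $A'\subset F$ that contains $A$ and is finitely generated as a $\mathbb{Z}$-algebra, the set $\mathcal{Y}(A')$ of $A'$-points of the $A$-scheme $\mathcal{Y}$ is finite. - $Y$ is *geometrically hyperbolic over $F$* if, for every smooth integral curve $C$ over $F$ (an integral, finite type, separated $F$-scheme, smooth of relative dimension one), every $c\in C(F)$ and every $y\in Y(F)$,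 the set of morphisms of $F$-schemes $f\colon C\to Y$ with $f(c)=y$ is finite. -/

import Mathlib

open CategoryTheory CategoryTheory.Limits AlgebraicGeometry

universe u

noncomputable section

/-- The morphism `p : X ⟶ S` makes `X` a scheme of finite type and separated over `S`.
For `S = Spec k` with `k` a field this says that `X` is a variety over `k` (varieties need not be
irreducible, reduced or nonempty). -/
structure IsFiniteTypeSeparated {X S : Scheme.{u}} (p : X ⟶ S) : Prop where
  locallyOfFiniteType : LocallyOfFiniteType p
  quasiCompact : QuasiCompact p
  isSeparated : IsSeparated p

/-- The structure morphism `X ×_{Spec R} Spec S ⟶ Spec S` of the base change of a scheme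
`p : X ⟶ Spec R` along `Spec S ⟶ Spec R`, for an `R`-algebra `S`. -/
abbrev baseChangeHom (R S : Type u) [CommRing R] [CommRing S] [Algebra R S] {X : Scheme.{u}}
    (p : X ⟶ Spec (CommRingCat.of R)) :
    pullback p (Spec.map (CommRingCat.ofHom (algebraMap R S))) ⟶ Spec (CommRingCat.of S) :=
  pullback.snd p (Spec.map (CommRingCat.ofHom (algebraMap R S)))

/-- The set `𝒳(A')` of `A'`-points, over `A`, of an `A`-scheme `π : 𝒳 ⟶ Spec A`, for subrings
`A ⊆ A'` of a field. -/
def integralPoints {k : Type u} [Field k] {A A' : Subring k} (h : A ≤ A') {𝒳 : Scheme.{u}}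
    (π : 𝒳 ⟶ Spec (CommRingCat.of A)) : Set (Spec (CommRingCat.of A') ⟶ 𝒳) :=
  {s | s ≫ π = Spec.map (CommRingCat.ofHom (Subring.inclusion h))}

/-- Arithmetic hyperbolicity over `k` of a finite type separated scheme `p : X ⟶ Spec k`: there
are a subring `A` of `k` that is finitely generated as a ring and a finite type separated
`A`-scheme `𝒳`, with base change to `k` isomorphic to `X` over `k`, such that `𝒳(A')` is finite
for every finitely generated subring `A'` of `k` that contains `A`. -/
def IsArithmeticallyHyperbolic (k : Type u) [Field k] [IsAlgClosed k] [CharZero k]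
    {X : Scheme.{u}} (p : X ⟶ Spec (CommRingCat.of k)) : Prop :=
  ∃ A : Subring k, Algebra.FiniteType ℤ A ∧
    ∃ (𝒳 : Scheme.{u}) (π : 𝒳 ⟶ Spec (CommRingCat.of A)), IsFiniteTypeSeparated π ∧
      Nonempty (Over.mk (baseChangeHom A k π) ≅ Over.mk p) ∧
      ∀ (A' : Subring k) (h : A ≤ A'), Algebra.FiniteType ℤ A' → (integralPoints h π).Finite

/-- `q : C ⟶ Spec k` is a smooth integral curve over `k`: an integral variety that is smooth of
relative dimension one over `k`. -/
structure IsSmoothIntegralCurve (k : Type u) [Field k] {C : Scheme.{u}}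
    (q : C ⟶ Spec (CommRingCat.of k)) : Prop where
  isFiniteTypeSeparated : IsFiniteTypeSeparated q
  isIntegral : IsIntegral C
  smooth : SmoothOfRelativeDimension 1 q

/-- Geometric hyperbolicity over `k` of a finite type separated scheme `p : X ⟶ Spec k`: for every
smooth integral curve `C` over `k`, every `c ∈ C(k)` and every `x ∈ X(k)`, only finitely many
`k`-morphisms `f : C ⟶ X` satisfy `f(c) = x`. -/
def IsGeometricallyHyperbolic (k : Type u) [Field k] [IsAlgClosed k] [CharZero k]
    {X : Scheme.{u}} (p : X ⟶ Spec (CommRingCat.of k)) : Prop :=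
  ∀ (C : Scheme.{u}) (q : C ⟶ Spec (CommRingCat.of k)), IsSmoothIntegralCurve k q →
    ∀ (c : Spec (CommRingCat.of k) ⟶ C) (x : Spec (CommRingCat.of k) ⟶ X),
      c ≫ q = 𝟙 _ → x ≫ p = 𝟙 _ →
        {f : C ⟶ X | f ≫ p = q ∧ c ≫ f = x}.Finite

end

/-!
Fix a model `π : 𝒳 ⟶ Spec A` of `X` witnessing arithmetic hyperbolicity over `k`. A finitely
generated ring `R` between `A` and a field is countable, so whether it is contained in `K` or in
`L` makes no difference: as `L` is uncountable and algebraically closed, every such `R ⊆ K` embeds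
into `L` over `A` (`exists_injective_algHom_of_countable`). The same model is therefore used over
every field, and it suffices to prove that `𝒳(R)` is finite for all finitely generated `R ⊆ L`
containing `A`.

This is done by climbing from `k` to `L` through algebraically closed subfields, adding one
transcendental element at a time
(`exists_isAlgClosed_subfield_hasFinitelyManyIntegralPoints`). Suppose that finiteness is known for
the finitely generated subrings of an algebraically closed field `E ⊆ L`, and let `R ⊆ L` be
algebraic over `E(t)`. After inverting one element, `E[t, R]` is the coordinate ring `D` of a smooth
integral curve over `E`, and this curve has an `E`-point `c` by the Nullstellensatz. Restriction to
`c` sends `𝒳(R)` to `𝒳(R')`, where `R'` is the image of `R` in `E`; this target is finite. Points of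
`𝒳(R)` with the same restriction to `c` give morphisms from the curve `Spec (L ⊗ D)` to `X_L` with
the same value at `c`, of which there are finitely many as `X_L` is geometrically hyperbolic, and
a point of `𝒳(R)` is recovered from its morphism because `𝒳` is separated and `R` embeds into
`L ⊗ D` (`finite_points_of_isStandardSmoothOfRelativeDimension_one`). The curve `Spec (L ⊗ D)` is
integral since `E` is algebraically closed (`isDomain_tensorProduct_of_isAlgClosed`).
-/

open scoped TensorProduct Polynomial

/-! ### Algebras of finite type over an algebraically closed field -/

/-- Closed points separate functions on an integral affine variety over an algebraically closed
field: this is the Nullstellensatz, applied to the localization away from `b`. -/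
theorem exists_algHom_ne_zero_of_isAlgClosed (E : Type*) {B : Type*} [Field E] [IsAlgClosed E]
    [CommRing B] [IsDomain B] [Algebra E B] [Algebra.FiniteType E B] {b : B} (hb : b ≠ 0) :
    ∃ φ : B →ₐ[E] E, φ b ≠ 0 := by
  have : Nontrivial (Localization.Away b) :=
    (IsLocalization.injective (Localization.Away b)
      (powers_le_nonZeroDivisors_of_noZeroDivisors hb)).nontrivial
  have : Algebra.FiniteType B (Localization.Away b) :=
    IsLocalization.finiteType_of_monoid_fg (Submonoid.powers b) _
  have : Algebra.FiniteType E (Localization.Away b) := .trans ‹_› this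
  obtain ⟨m, hm⟩ := Ideal.exists_maximal (Localization.Away b)
  let : Field (Localization.Away b ⧸ m) := Ideal.Quotient.field m
  have := finite_of_finite_type_of_isJacobsonRing E (Localization.Away b ⧸ m)
  let e : E ≃ₐ[E] (Localization.Away b ⧸ m) := AlgEquiv.ofBijective (Algebra.ofId _ _)
    IsAlgClosed.algebraMap_bijective_of_isIntegral
  let φ : B →ₐ[E] E := (e.symm : _ →ₐ[E] E).comp ((Ideal.Quotient.mkₐ E m).comp
    (IsScalarTower.toAlgHom E B (Localization.Away b)))
  exact ⟨φ, ((IsLocalization.Away.algebraMap_isUnit (S := Localization.Away b) b).map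
    ((e.symm : _ →ₐ[E] E).comp (Ideal.Quotient.mkₐ E m))).ne_zero⟩

/-- An integral affine variety over an algebraically closed field `E` stays integral after any
field extension `L` of `E`. If `x` and `y` are nonzero elements of `B ⊗ L`, written in an
`E`-basis of `L`, then at a closed point where some coordinate of `x` and some coordinate of `y`
do not vanish, `x` and `y` specialize to nonzero elements of `L`. -/
theorem isDomain_tensorProduct_of_isAlgClosed (E L B : Type*) [Field E] [IsAlgClosed E]
    [Field L] [Algebra E L] [CommRing B] [IsDomain B] [Algebra E B] [Algebra.FiniteType E B] :
    IsDomain (B ⊗[E] L) := by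
  have : Nontrivial (B ⊗[E] L) :=
    (Algebra.TensorProduct.includeLeft_injective (S := E) (R := E) (A := B) (B := L)
      (algebraMap E L).injective).nontrivial
  have : NoZeroDivisors (B ⊗[E] L) := by
    refine ⟨fun {x y} hxy ↦ ?_⟩
    by_contra! H
    let v := Module.Basis.ofVectorSpace E L
    let w := v.baseChange B
    -- Specializing at the closed point `φ` applies `φ` to each coordinate.
    have hw (φ : B →ₐ[E] E) (z : B ⊗[E] L) (i) (hz : φ (w.repr z i) ≠ 0) :
        Algebra.TensorProduct.lift ((Algebra.ofId E L).comp φ) (AlgHom.id E L)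
          (fun _ _ ↦ Commute.all _ _) z ≠ 0 := by
      intro h0
      apply hz
      have key : ∀ z, v.repr (Algebra.TensorProduct.lift ((Algebra.ofId E L).comp φ)
          (AlgHom.id E L) (fun _ _ ↦ Commute.all _ _) z) i = φ (w.repr z i) := by
        intro z
        induction z with
        | zero => simp
        | add a b ha hb => simp [ha, hb]
        | tmul b l =>
          simp only [Algebra.TensorProduct.lift_tmul, AlgHom.coe_comp, Function.comp_apply,
            Algebra.ofId_apply, AlgHom.coe_id, id_eq, ← Algebra.smul_def, map_smul]
          simp [w, mul_comm]
      rw [← key, h0]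
      simp
    obtain ⟨i, hi⟩ : ∃ i, w.repr x i ≠ 0 := by
      by_contra! h
      exact H.1 (w.repr.map_eq_zero_iff.mp (Finsupp.ext h))
    obtain ⟨j, hj⟩ : ∃ i, w.repr y i ≠ 0 := by
      by_contra! h
      exact H.2 (w.repr.map_eq_zero_iff.mp (Finsupp.ext h))
    obtain ⟨φ, hφ⟩ := exists_algHom_ne_zero_of_isAlgClosed E (mul_ne_zero hi hj)
    rw [map_mul, mul_ne_zero_iff] at hφ
    refine mul_ne_zero (hw φ x i hφ.1) (hw φ y j hφ.2) ?_
    rw [← map_mul, hxy, map_zero]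
  exact NoZeroDivisors.to_isDomain _

/-! ### Generic smoothness -/

theorem Polynomial.isStandardSmoothOfRelativeDimension_one (E : Type*) [Field E] :
    Algebra.IsStandardSmoothOfRelativeDimension 1 E E[X] := by
  let b : Module.Basis Unit E[X] (Ω[E[X]⁄E]) :=
    .ofRepr ((KaehlerDifferential.polynomialEquiv E).trans
      (Module.Basis.singleton Unit E[X]).repr)
  have : Algebra.IsStandardSmooth E E[X] := by
    refine Algebra.IsStandardSmooth.of_basis_kaehlerDifferential b ?_
    rintro _ ⟨i, rfl⟩
    refine ⟨Polynomial.X, ?_⟩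
    apply b.repr.injective
    simp [b]
  rw [Algebra.IsStandardSmoothOfRelativeDimension.iff_of_isStandardSmooth, rank_eq_card_basis b]
  simp

/-- A generically finite extension of integral domains of characteristic zero, of finite
presentation, is étale over a nonempty basic open set: at the generic point it is a localization
followed by a separable extension of fields. -/
theorem exists_etale_localizationAway_of_isAlgebraic (R S : Type*) [CommRing R] [IsDomain R]
    [CharZero R] [CommRing S] [IsDomain S] [Algebra R S] [FaithfulSMul R S]
    [Algebra.IsAlgebraic R S] [Algebra.FinitePresentation R S] :
    ∃ f : S, f ≠ 0 ∧ Algebra.Etale R (Localization.Away f) := by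
  have : IsFractionRing S (Localization.AtPrime (⊥ : Ideal S)) := by
    simpa [Ideal.primeCompl_bot] using Localization.isLocalization (M := (⊥ : Ideal S).primeCompl)
  let : Field (Localization.AtPrime (⊥ : Ideal S)) := IsFractionRing.toField S
  have : FaithfulSMul R (Localization.AtPrime (⊥ : Ideal S)) := by
    rw [faithfulSMul_iff_algebraMap_injective,
      IsScalarTower.algebraMap_eq R S (Localization.AtPrime ⊥)]
    exact (IsFractionRing.injective S _).comp (FaithfulSMul.algebraMap_injective R S)
  let := FractionRing.liftAlgebra R (Localization.AtPrime (⊥ : Ideal S))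
  have := FractionRing.isScalarTower_liftAlgebra R (Localization.AtPrime (⊥ : Ideal S))
  have : Algebra.IsAlgebraic R (Localization.AtPrime (⊥ : Ideal S)) :=
    (IsFractionRing.isAlgebraic_iff' R S _).1 inferInstance
  have : Algebra.IsAlgebraic (FractionRing R) (Localization.AtPrime (⊥ : Ideal S)) :=
    ⟨fun x ↦ (IsFractionRing.isAlgebraic_iff R (FractionRing R) _).1
      (Algebra.IsAlgebraic.isAlgebraic x)⟩
  have : Algebra.FormallyEtale (FractionRing R) (Localization.AtPrime (⊥ : Ideal S)) :=
    .of_isSeparable _ _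
  have : Algebra.FormallyEtale R (FractionRing R) := .of_isLocalization (nonZeroDivisors R)
  have : Algebra.IsEtaleAt R (⊥ : Ideal S) :=
    Algebra.FormallyEtale.comp R (FractionRing R) (Localization.AtPrime ⊥)
  obtain ⟨f, hf, h⟩ := Algebra.exists_etale_of_isEtaleAt (R := R) (⊥ : Ideal S)
  exact ⟨f, by simpa using hf, h⟩

/-- A finitely generated integral domain of transcendence degree one over a field of characteristic
zero becomes, after inverting one element, the coordinate ring of a smooth affine curve. -/
theorem exists_isStandardSmoothOfRelativeDimension_one (E B : Type*) [Field E] [CharZero E]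
    [CommRing B] [IsDomain B] [Algebra E B] [Algebra.FiniteType E B] (t : B)
    (ht : Transcendental E t) [Algebra.IsAlgebraic (Algebra.adjoin E {t}) B] :
    ∃ f : B, f ≠ 0 ∧ Algebra.IsStandardSmoothOfRelativeDimension 1 E (Localization.Away f) := by
  let : Algebra E[X] B := (Polynomial.aeval t).toRingHom.toAlgebra
  have hmap (q : E[X]) : algebraMap E[X] B q = Polynomial.aeval t q := rfl
  have : IsScalarTower E E[X] B := .of_algebraMap_eq fun x ↦ by
    simp [hmap, Polynomial.algebraMap_eq]
  have : FaithfulSMul E[X] B := by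
    rw [faithfulSMul_iff_algebraMap_injective]
    exact transcendental_iff_injective.mp ht
  have : Algebra.FiniteType E[X] B := .of_restrictScalars_finiteType E _ _
  have : Algebra.FinitePresentation E[X] B := Algebra.FinitePresentation.of_finiteType.mp this
  have : Algebra.IsAlgebraic E[X] B := by
    refine ⟨fun b ↦ ?_⟩
    have hb := Algebra.IsAlgebraic.isAlgebraic (R := Algebra.adjoin E {t}) b
    refine hb.of_ringHom_of_comp_eq (g := RingHom.id B)
      ((Polynomial.aeval (R := E) t).codRestrict (Algebra.adjoin E {t})
        fun q ↦ Algebra.adjoin_singleton_eq_range_aeval E t ▸ ⟨q, rfl⟩).toRingHom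
      ?_ Function.injective_id rfl
    rintro ⟨y, hy⟩
    obtain ⟨q, rfl⟩ := Algebra.adjoin_singleton_eq_range_aeval E t ▸ hy
    exact ⟨q, rfl⟩
  obtain ⟨f, hf, h⟩ := exists_etale_localizationAway_of_isAlgebraic E[X] B
  have := Polynomial.isStandardSmoothOfRelativeDimension_one E
  have := Algebra.Etale.iff_isStandardSmoothOfRelativeDimension_zero.mp h
  exact ⟨f, hf, .trans 1 0 E E[X] (Localization.Away f)⟩

/-! ### Smooth integral curves and separated targets -/

theorem isSmoothIntegralCurve_baseChange (E L D : Type u) [Field E] [IsAlgClosed E] [Field L]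
    [Algebra E L] [CommRing D] [IsDomain D] [Algebra E D]
    [Algebra.IsStandardSmoothOfRelativeDimension 1 E D] :
    IsSmoothIntegralCurve L (Spec.map (CommRingCat.ofHom (algebraMap L (L ⊗[E] D)))) := by
  have : Algebra.IsStandardSmooth E D :=
    Algebra.IsStandardSmoothOfRelativeDimension.isStandardSmooth 1
  have : Algebra.FiniteType E D := inferInstance
  have : IsDomain (D ⊗[E] L) := isDomain_tensorProduct_of_isAlgClosed E L D
  have : IsDomain (L ⊗[E] D) := (Algebra.TensorProduct.comm E L D).toMulEquiv.isDomain
  refine ⟨⟨?_, inferInstance, inferInstance⟩, ?_, ?_⟩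
  · rw [HasRingHomProperty.Spec_iff (P := @LocallyOfFiniteType)]
    exact RingHom.finiteType_algebraMap.mpr inferInstance
  · infer_instance
  · rw [HasRingHomProperty.Spec_iff (P := @SmoothOfRelativeDimension 1)]
    refine RingHom.locally_of RingHom.isStandardSmoothOfRelativeDimension_respectsIso _ ?_
    exact (RingHom.isStandardSmoothOfRelativeDimension_algebraMap 1).mpr inferInstance

theorem isDominant_SpecMap_of_injective {R S : Type u} [CommRing R] [CommRing S] (f : R →+* S)
    (hf : Function.Injective f) : IsDominant (Spec.map (CommRingCat.ofHom f)) := by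
  rw [isDominant_iff]
  refine (PrimeSpectrum.denseRange_comap_iff_ker_le_nilRadical f).mpr ?_
  rw [(RingHom.injective_iff_ker_eq_bot f).mp hf]
  exact bot_le

/-- A morphism to a separated scheme, from an affine reduced scheme, is determined by its
restriction along an injective ring homomorphism. -/
theorem eq_of_SpecMap_comp_eq {R S : Type u} [CommRing R] [IsReduced R] [CommRing S] (f : R →+* S)
    (hf : Function.Injective f) {X Z : Scheme.{u}} (π : X ⟶ Z) [IsSeparated π]
    {a b : Spec (CommRingCat.of R) ⟶ X} (h : a ≫ π = b ≫ π)
    (hab : Spec.map (CommRingCat.ofHom f) ≫ a = Spec.map (CommRingCat.ofHom f) ≫ b) : a = b :=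
  have := isDominant_SpecMap_of_injective f hf
  ext_of_isDominant_of_isSeparated π h (Spec.map (CommRingCat.ofHom f)) hab

/-! ### Integral points over a field of transcendence degree one -/

/-- `π : 𝒳 ⟶ Spec A` has finitely many integral points over `ι : A →+* F` if `𝒳(R)` is finite for
every finitely generated ring `R` that lies between `A` and `F`. Here `R` is not taken to be a
subring of `F`, but a ring with an injective homomorphism to `F`, so that it can be moved from one
field to another. -/
def HasFinitelyManyIntegralPoints {A F : Type u} [CommRing A] [Field F] {𝒳 : Scheme.{u}}
    (π : 𝒳 ⟶ Spec (CommRingCat.of A)) (ι : A →+* F) : Prop :=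
  ∀ (R : Type u) [CommRing R], Algebra.FiniteType ℤ R → ∀ (φ : A →+* R) (ψ : R →+* F),
    Function.Injective ψ → ψ.comp φ = ι →
      {s : Spec (CommRingCat.of R) ⟶ 𝒳 | s ≫ π = Spec.map (CommRingCat.ofHom φ)}.Finite

/-- If `R` is contained in the coordinate ring `D` of a smooth integral affine curve over `E`, then
`R`-points of `𝒳` are determined up to finitely many choices by their restriction to one `E`-point
of the curve, and these restrictions are integral points over a finitely generated subring
of `E`. -/
theorem finite_points_of_isStandardSmoothOfRelativeDimension_one {A R E L D : Type u} [CommRing A]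
    [CommRing R] [IsDomain R] [Field E] [IsAlgClosed E] [Field L] [IsAlgClosed L] [CharZero L]
    [Algebra E L]
    [CommRing D] [IsDomain D] [Algebra E D] [Algebra.IsStandardSmoothOfRelativeDimension 1 E D]
    {𝒳 Y : Scheme.{u}} {π : 𝒳 ⟶ Spec (CommRingCat.of A)} [IsSeparated π] {ι : A →+* E}
    {p : Y ⟶ Spec (CommRingCat.of L)} {ρ : Y ⟶ 𝒳}
    (hY : IsPullback ρ p π (Spec.map (CommRingCat.ofHom ((algebraMap E L).comp ι))))
    (hgeom : IsGeometricallyHyperbolic L p)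
    (hE : HasFinitelyManyIntegralPoints π ι) (hR : Algebra.FiniteType ℤ R)
    (φ : A →+* R) (η : R →+* D) (hη : Function.Injective η)
    (hφ : η.comp φ = (algebraMap E D).comp ι) :
    {s : Spec (CommRingCat.of R) ⟶ 𝒳 | s ≫ π = Spec.map (CommRingCat.ofHom φ)}.Finite := by
  have : Algebra.IsStandardSmooth E D :=
    Algebra.IsStandardSmoothOfRelativeDimension.isStandardSmooth 1
  obtain ⟨c, -⟩ := exists_algHom_ne_zero_of_isAlgClosed E (one_ne_zero (α := D))
  let θ : R →+* E := (c : D →+* E).comp η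
  have hθ : Algebra.FiniteType ℤ θ.range :=
    hR.of_surjective (θ.rangeRestrict.toIntAlgHom) θ.rangeRestrict_surjective
  have hφE : θ.range.subtype.comp (θ.rangeRestrict.comp φ) = ι := by
    ext a
    have := congr(c ($hφ a))
    simpa [θ] using this
  refine Set.Finite.of_finite_fibers
    (fun s ↦ Spec.map (CommRingCat.ofHom θ.rangeRestrict) ≫ s) ?_ ?_
  · refine (hE θ.range hθ (θ.rangeRestrict.comp φ) θ.range.subtype Subtype.val_injective
      hφE).subset ?_
    rintro _ ⟨s, hs, rfl⟩
    simp only [Set.mem_ofPred_eq] at hs ⊢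
    rw [Category.assoc, hs, ← Spec.map_comp, ← CommRingCat.ofHom_comp]
  · rintro x' ⟨s₀, hs₀, rfl⟩
    -- `q` is the base change of the curve to `L`, `r` its map to `Spec R`, `pt` its base point.
    let q := Spec.map (CommRingCat.ofHom (algebraMap L (L ⊗[E] D)))
    let r : R →+* L ⊗[E] D :=
      (Algebra.TensorProduct.includeRight : D →ₐ[E] L ⊗[E] D).toRingHom.comp η
    have hr : Function.Injective r :=
      (Algebra.TensorProduct.includeRight_injective (algebraMap E L).injective).comp hη
    let cL : L ⊗[E] D →ₐ[L] L := Algebra.TensorProduct.lift (AlgHom.id L L)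
      ((Algebra.ofId E L).comp c) fun _ _ ↦ Commute.all _ _
    have hcr : (cL : L ⊗[E] D →+* L).comp r = (algebraMap E L).comp θ := by
      ext a
      simp [cL, r, θ, Algebra.ofId_apply]
    have hrφ : r.comp φ = (algebraMap L (L ⊗[E] D)).comp ((algebraMap E L).comp ι) := by
      ext a
      have := congr(Algebra.TensorProduct.includeRight (R := E) (A := L) ($hφ a))
      simp only [RingHom.comp_apply, AlgHom.commutes] at this
      simp only [r, RingHom.comp_apply]
      exact this
    let pt : Spec (CommRingCat.of L) ⟶ Spec (CommRingCat.of (L ⊗[E] D)) :=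
      Spec.map (CommRingCat.ofHom (cL : L ⊗[E] D →+* L))
    have hpt : pt ≫ q = 𝟙 _ := by
      rw [← Spec.map_comp, ← CommRingCat.ofHom_comp, AlgHom.comp_algebraMap,
        Algebra.algebraMap_self, CommRingCat.ofHom_id, Spec.map_id]
    have hlift (s : Spec (CommRingCat.of R) ⟶ 𝒳) (hs : s ≫ π = Spec.map (CommRingCat.ofHom φ)) :
        (Spec.map (CommRingCat.ofHom r) ≫ s) ≫ π =
          q ≫ Spec.map (CommRingCat.ofHom ((algebraMap E L).comp ι)) := by
      rw [Category.assoc, hs, ← Spec.map_comp, ← Spec.map_comp, ← CommRingCat.ofHom_comp,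
        ← CommRingCat.ofHom_comp, hrφ]
    classical
    -- `F s` is the morphism from the curve to `Y` given by `s`; off `𝒳(R)` its value is arbitrary.
    let F : (Spec (CommRingCat.of R) ⟶ 𝒳) → (Spec (CommRingCat.of (L ⊗[E] D)) ⟶ Y) := fun s ↦
      if hs : s ≫ π = Spec.map (CommRingCat.ofHom φ) then hY.lift _ q (hlift s hs)
      else hY.lift _ q (hlift s₀ hs₀)
    have hF (s) (hs : s ≫ π = Spec.map (CommRingCat.ofHom φ)) :
        F s ≫ ρ = Spec.map (CommRingCat.ofHom r) ≫ s ∧ F s ≫ p = q := by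
      simp [F, hs]
    refine Set.Finite.of_finite_image (f := F) ?_ ?_
    · refine (hgeom _ q (isSmoothIntegralCurve_baseChange E L D) pt (pt ≫ F s₀) hpt ?_).subset ?_
      · rw [Category.assoc, (hF s₀ hs₀).2, hpt]
      · rintro _ ⟨s, ⟨hs, hss₀⟩, rfl⟩
        refine ⟨(hF s hs).2, hY.hom_ext ?_ ?_⟩
        · have key (s : Spec (CommRingCat.of R) ⟶ 𝒳) : pt ≫ Spec.map (CommRingCat.ofHom r) ≫ s =
            Spec.map (CommRingCat.ofHom ((algebraMap E L).comp θ.range.subtype)) ≫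
              (Spec.map (CommRingCat.ofHom θ.rangeRestrict) ≫ s) := by
            rw [← Spec.map_comp_assoc, ← Spec.map_comp_assoc, ← CommRingCat.ofHom_comp,
              ← CommRingCat.ofHom_comp, hcr]
            rfl
          simp only [Set.mem_preimage, Set.mem_singleton_iff] at hss₀
          rw [Category.assoc, Category.assoc, (hF s hs).1, (hF s₀ hs₀).1, key, key, hss₀]
        · rw [Category.assoc, Category.assoc, (hF s hs).2, (hF s₀ hs₀).2]
    · rintro s ⟨hs, -⟩ s' ⟨hs', -⟩ hss'
      refine eq_of_SpecMap_comp_eq r hr π (hs.trans hs'.symm) ?_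
      rw [← (hF s hs).1, ← (hF s' hs').1, hss']

theorem RingHom.apply_mem_of_adjoin_int_eq_top {R T : Type*} [CommRing R] [CommRing T] {σ : Set R}
    (hσ : Algebra.adjoin ℤ σ = ⊤) (ψ : R →+* T) {S : Subring T} (h : ∀ x ∈ σ, ψ x ∈ S) (r : R) :
    ψ r ∈ S := by
  have hr : r ∈ Algebra.adjoin ℤ σ := hσ ▸ trivial
  exact Algebra.adjoin_le (S := subalgebraOfSubring (S.comap ψ)) h hr

/-- `𝒳(R)` is finite for a finitely generated ring `R ⊆ L` that is algebraic over `E(t)`: up to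
inverting one element, the `E`-algebra generated by `t` and `R` is the coordinate ring of a smooth
curve. -/
theorem finite_points_of_isAlgebraic_adjoin_singleton {A R E L : Type u} [CommRing A]
    [CommRing R] [Field E] [IsAlgClosed E] [Field L] [IsAlgClosed L] [CharZero L] [Algebra E L]
    {𝒳 Y : Scheme.{u}} {π : 𝒳 ⟶ Spec (CommRingCat.of A)} [IsSeparated π] {ι : A →+* E}
    {p : Y ⟶ Spec (CommRingCat.of L)} {ρ : Y ⟶ 𝒳}
    (hY : IsPullback ρ p π (Spec.map (CommRingCat.ofHom ((algebraMap E L).comp ι))))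
    (hgeom : IsGeometricallyHyperbolic L p)
    (hE : HasFinitelyManyIntegralPoints π ι) (hR : Algebra.FiniteType ℤ R)
    (φ : A →+* R) (ψ : R →+* L) (hψ : Function.Injective ψ)
    (hφ : ψ.comp φ = (algebraMap E L).comp ι)
    (t : L) (htE : Transcendental E t) (ht : ∀ r, IsAlgebraic (Algebra.adjoin E {t}) (ψ r)) :
    {s : Spec (CommRingCat.of R) ⟶ 𝒳 | s ≫ π = Spec.map (CommRingCat.ofHom φ)}.Finite := by
  have := hψ.isDomain
  obtain ⟨σ, hσ⟩ := hR.out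
  let B : Subalgebra E L := Algebra.adjoin E (insert t (ψ '' σ))
  have hψB (r : R) : ψ r ∈ B :=
    ψ.apply_mem_of_adjoin_int_eq_top hσ (S := B.toSubring)
      (fun x hx ↦ Algebra.subset_adjoin (.inr ⟨x, hx, rfl⟩)) r
  have : Algebra.FiniteType E B :=
    (Subalgebra.fg_iff_finiteType _).mp
      (Subalgebra.fg_def.mpr ⟨_, (σ.finite_toSet.image ψ).insert t, rfl⟩)
  let t' : B := ⟨t, Algebra.subset_adjoin (.inl rfl)⟩
  have ht' : Transcendental E t' := fun h ↦ htE (h.algebraMap (A := L))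
  have : CharZero E := (RingHom.charZero_iff (algebraMap E L).injective).mpr inferInstance
  have : Algebra.IsAlgebraic (Algebra.adjoin E {t'}) B := by
    refine ⟨fun b ↦ ?_⟩
    have hb : IsAlgebraic (Algebra.adjoin E {t}) (b : L) := by
      refine IsAlgebraic.adjoin_of_forall_isAlgebraic (s := insert t (ψ '' σ)) ?_
        (isAlgebraic_algebraMap (A := L) b)
      rintro _ ⟨rfl | ⟨r, -, rfl⟩, h⟩
      · exact absurd rfl h
      · exact ht r
    have hmap : (Algebra.adjoin E {t'}).map B.val = Algebra.adjoin E {t} := by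
      rw [AlgHom.map_adjoin, Set.image_singleton]; rfl
    refine hb.of_ringHom_of_comp_eq (g := B.val)
      ((B.val.comp (Algebra.adjoin E {t'}).val).codRestrict (Algebra.adjoin E {t})
        fun x ↦ hmap ▸ ⟨x, x.2, rfl⟩) ?_ Subtype.val_injective rfl
    rintro ⟨y, hy⟩
    obtain ⟨x, hx, rfl⟩ := hmap ▸ hy
    exact ⟨⟨x, hx⟩, rfl⟩
  obtain ⟨f, hf, hD⟩ := exists_isStandardSmoothOfRelativeDimension_one E B t' ht'
  have hle := powers_le_nonZeroDivisors_of_noZeroDivisors hf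
  have : IsDomain (Localization.Away f) := IsLocalization.isDomain_localization hle
  let ψB : R →+* B := ψ.codRestrict B hψB
  have hψφ : ψB.comp φ = (algebraMap E B).comp ι := by
    ext a
    exact congr($hφ a)
  refine finite_points_of_isStandardSmoothOfRelativeDimension_one hY hgeom hE hR φ
    ((algebraMap B (Localization.Away f)).comp ψB) ?_ ?_
  · exact (IsLocalization.injective _ hle).comp fun x y h ↦ hψ congr(($h).1)
  · rw [RingHom.comp_assoc, hψφ, ← RingHom.comp_assoc, ← IsScalarTower.algebraMap_eq]

/-! ### Climbing from the base field to an extension -/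

/-- Every finite subset of `L` is contained in an algebraically closed subfield over which `𝒳` has
finitely many integral points. -/
theorem exists_isAlgClosed_subfield_hasFinitelyManyIntegralPoints {A k L : Type u} [CommRing A]
    [Field k] [IsAlgClosed k] [Field L] [IsAlgClosed L] [CharZero L] [Algebra k L]
    {𝒳 Y : Scheme.{u}} {π : 𝒳 ⟶ Spec (CommRingCat.of A)} [IsSeparated π] {ι : A →+* k}
    {p : Y ⟶ Spec (CommRingCat.of L)} {ρ : Y ⟶ 𝒳}
    (hY : IsPullback ρ p π (Spec.map (CommRingCat.ofHom ((algebraMap k L).comp ι))))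
    (hgeom : IsGeometricallyHyperbolic L p)
    (hk : HasFinitelyManyIntegralPoints π ι) (σ : Finset L) :
    ∃ (E : Subfield L) (ιE : A →+* E), IsAlgClosed E ∧ ↑σ ⊆ (E : Set L) ∧
      E.subtype.comp ιE = (algebraMap k L).comp ι ∧ HasFinitelyManyIntegralPoints π ιE := by
  classical
  induction σ using Finset.induction with
  | empty =>
    let e : k ≃+* (algebraMap k L).fieldRange :=
      .ofBijective (algebraMap k L).rangeRestrictField
        (algebraMap k L).rangeRestrictField_bijective
    refine ⟨(algebraMap k L).fieldRange, (e : k →+* _).comp ι, .of_ringEquiv k _ e, by simp, rfl,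
      fun R _ hR φ ψ hψ hφ ↦ hk R hR φ ((e.symm : _ →+* k).comp ψ) ?_ ?_⟩
    · exact e.symm.injective.comp hψ
    · rw [RingHom.comp_assoc, hφ, ← RingHom.comp_assoc]
      ext
      simp
  | insert t σ _ ih =>
    obtain ⟨E, ιE, hE, hσE, hι, hfin⟩ := ih
    by_cases htE : t ∈ E
    · exact ⟨E, ιE, hE, by simpa [Set.insert_subset_iff, htE] using hσE, hι, hfin⟩
    have ht : Transcendental E t := by
      refine fun h ↦ htE ?_
      obtain ⟨y, hy⟩ := (IsAlgClosed.algebraMap_bijective_of_isIntegral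
        (k := E) (K := algebraicClosure E L)).2 ⟨t, mem_algebraicClosure_iff.mpr h⟩
      have hyt : (y : L) = t := congr(($hy).1)
      exact hyt ▸ y.2
    -- The next field is the algebraic closure of `E(t)` in `L`.
    let G := IntermediateField.adjoin E {t}
    let E' : Subfield L := (algebraicClosure G L).toSubfield
    have hEE' (x : L) (hx : x ∈ E) : x ∈ E' :=
      (algebraicClosure G L).algebraMap_mem (algebraMap E G ⟨x, hx⟩)
    have hE'L : IsAlgClosed E' := IsAlgClosure.isAlgClosed (K := algebraicClosure G L) G
    refine ⟨E', (Subfield.inclusion hEE').comp ιE, hE'L, ?_, hι, fun R _ hR φ ψ hψ hφ ↦ ?_⟩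
    · rw [Finset.coe_insert, Set.insert_subset_iff]
      exact ⟨(algebraicClosure G L).algebraMap_mem
          ⟨t, IntermediateField.mem_adjoin_simple_self E t⟩,
        fun x hx ↦ hEE' x (hσE hx)⟩
    · refine finite_points_of_isAlgebraic_adjoin_singleton (E := E) (ι := ιE) (ρ := ρ)
        ?_ hgeom hfin hR φ (E'.subtype.comp ψ) (E'.subtype_injective.comp hψ) ?_ t ht fun r ↦ ?_
      · rw [← hι] at hY
        exact hY
      · rw [RingHom.comp_assoc, hφ]
        rfl
      · exact IntermediateField.isAlgebraic_adjoin_iff.mp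
          (mem_algebraicClosure_iff.mp (ψ r).2)

theorem HasFinitelyManyIntegralPoints.of_isGeometricallyHyperbolic {A k L : Type u} [CommRing A]
    [Field k] [IsAlgClosed k] [Field L] [IsAlgClosed L] [CharZero L] [Algebra k L]
    {𝒳 Y : Scheme.{u}} {π : 𝒳 ⟶ Spec (CommRingCat.of A)} [IsSeparated π] {ι : A →+* k}
    {p : Y ⟶ Spec (CommRingCat.of L)} {ρ : Y ⟶ 𝒳}
    (hk : HasFinitelyManyIntegralPoints π ι)
    (hY : IsPullback ρ p π (Spec.map (CommRingCat.ofHom ((algebraMap k L).comp ι))))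
    (hgeom : IsGeometricallyHyperbolic L p) :
    HasFinitelyManyIntegralPoints π ((algebraMap k L).comp ι) := by
  classical
  intro R _ hR φ ψ hψ hφ
  obtain ⟨σ, hσ⟩ := hR.out
  obtain ⟨E, ιE, hE, hσE, hι, hfin⟩ :=
    exists_isAlgClosed_subfield_hasFinitelyManyIntegralPoints hY hgeom hk (σ.image ψ)
  have hψE (r : R) : ψ r ∈ E :=
    ψ.apply_mem_of_adjoin_int_eq_top hσ (S := E.toSubring)
      (fun x hx ↦ hσE (by simpa using ⟨x, hx, rfl⟩)) r
  refine hfin R hR φ (ψ.codRestrict E hψE) (fun x y h ↦ hψ congr(($h).1)) ?_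
  ext a
  exact congr($(hφ.trans hι.symm) a)

/-! ### Moving finitely generated rings between fields -/

theorem Algebra.FiniteType.countable_of_int (R : Type*) [CommRing R] [h : Algebra.FiniteType ℤ R] :
    Countable R := by
  obtain ⟨n, f, hf⟩ := Algebra.FiniteType.iff_quotient_mvPolynomial''.mp h
  have : Countable (MvPolynomial (Fin n) ℤ) := by
    rw [← Cardinal.mk_le_aleph0_iff]
    exact MvPolynomial.cardinalMk_le_max.trans (by simp)
  exact hf.countable

theorem exists_injective_ringHom_of_isAlgebraic {S R L : Type*} [CommRing S] [CommRing R]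
    [IsDomain R] [Field L] [IsAlgClosed L] [Algebra S R] [FaithfulSMul S R]
    [Algebra.IsAlgebraic S R] (j : S →+* L) (hj : Function.Injective j) :
    ∃ f : R →+* L, Function.Injective f ∧ f.comp (algebraMap S R) = j := by
  have := hj.isDomain
  algebraize [j]
  have : FaithfulSMul S L := (faithfulSMul_iff_algebraMap_injective S L).mpr hj
  let f : R →ₐ[S] L := IsAlgClosed.lift
  refine ⟨f, ?_, f.comp_algebraMap⟩
  let : Algebra R L := f.toRingHom.toAlgebra
  have : IsScalarTower S R L := .of_algebraMap_eq fun a ↦ (f.commutes a).symm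
  exact Algebra.IsAlgebraic.injective_tower_top (R := S) R hj

/-- A countable extension `R` of an integral domain `A` embeds over `A` into any uncountable
algebraically closed field `L` that contains `A`: since `L` has infinite transcendence degree over
`A`, a transcendence basis of `R` embeds into one of `L`, and the rest of `R` is algebraic. -/
theorem exists_injective_algHom_of_countable (A R L : Type u) [CommRing A] [CommRing R]
    [IsDomain R] [Field L] [IsAlgClosed L] [Algebra A R] [Algebra A L] [FaithfulSMul A R]
    [FaithfulSMul A L] [Countable R] [Uncountable L] :
    ∃ f : R →ₐ[A] L, Function.Injective f := by
  have : Countable A := (FaithfulSMul.algebraMap_injective A R).countable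
  have : IsDomain A := (FaithfulSMul.algebraMap_injective A R).isDomain
  obtain ⟨ι, x, hx⟩ := exists_isTranscendenceBasis' A R
  obtain ⟨J, y, hy⟩ := exists_isTranscendenceBasis' A L
  have : Countable ι := hx.1.injective.countable
  have hJ : Cardinal.aleph0 < Cardinal.mk J := by
    have h := IsAlgClosed.cardinal_le_max_transcendence_basis' y hy
    have hL : Cardinal.aleph0 < Cardinal.mk L := Cardinal.aleph0_lt_mk
    have hA : Cardinal.mk A ≤ Cardinal.aleph0 := Cardinal.mk_le_aleph0
    by_contra! hle
    exact absurd (h.trans (max_le (max_le hA hle) le_rfl)) hL.not_ge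
  obtain ⟨g⟩ : Nonempty (ι ↪ J) := (Cardinal.mk_le_aleph0 (α := ι)).trans hJ.le
  have hyg : AlgebraicIndependent A (y ∘ g) := hy.1.comp g g.injective
  let j : Algebra.adjoin A (Set.range x) →ₐ[A] L :=
    (MvPolynomial.aeval (y ∘ g)).comp (hx.1.aevalEquiv.symm : _ →ₐ[A] MvPolynomial ι A)
  have hj : Function.Injective j := fun a b h ↦ hx.1.aevalEquiv.symm.injective (hyg h)
  have := hx.isAlgebraic
  obtain ⟨f, hf, hfj⟩ := exists_injective_ringHom_of_isAlgebraic (R := R) j.toRingHom hj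
  exact ⟨⟨f, fun a ↦ congr($hfj (algebraMap A _ a)).trans (j.commutes a)⟩, hf⟩

/-- Finiteness over one uncountable algebraically closed field that contains `A` implies finiteness
over every field that contains `A`. -/
theorem HasFinitelyManyIntegralPoints.of_uncountable {A L K : Type u} [CommRing A] [Field L]
    [IsAlgClosed L] [Uncountable L] [Field K] {𝒳 : Scheme.{u}} {π : 𝒳 ⟶ Spec (CommRingCat.of A)}
    {ι : A →+* L} (hι : Function.Injective ι) {κ : A →+* K} (hκ : Function.Injective κ)
    (hL : HasFinitelyManyIntegralPoints π ι) : HasFinitelyManyIntegralPoints π κ := by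
  intro R _ hR φ ψ hψ hφ
  have hφi : Function.Injective φ := by
    rw [← hφ] at hκ
    exact Function.Injective.of_comp hκ
  algebraize [φ, ι]
  have := hψ.isDomain
  have := Algebra.FiniteType.countable_of_int R
  have : FaithfulSMul A R := (faithfulSMul_iff_algebraMap_injective _ _).mpr hφi
  have : FaithfulSMul A L := (faithfulSMul_iff_algebraMap_injective _ _).mpr hι
  obtain ⟨f, hf⟩ := exists_injective_algHom_of_countable A R L
  exact hL R hR φ f hf f.comp_algebraMap

/-! ### Arithmetic hyperbolicity in terms of a fixed model -/

theorem hasFinitelyManyIntegralPoints_subtype {k : Type u} [Field k] {A : Subring k}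
    {𝒳 : Scheme.{u}} {π : 𝒳 ⟶ Spec (CommRingCat.of A)}
    (h : ∀ (A' : Subring k) (h : A ≤ A'), Algebra.FiniteType ℤ A' → (integralPoints h π).Finite) :
    HasFinitelyManyIntegralPoints π A.subtype := by
  intro R _ hR φ ψ hψ hφ
  have hA : A ≤ ψ.range := fun a ha ↦ ⟨φ ⟨a, ha⟩, congr($hφ ⟨a, ha⟩)⟩
  have hψR : Algebra.FiniteType ℤ ψ.range :=
    hR.of_surjective ψ.rangeRestrict.toIntAlgHom ψ.rangeRestrict_surjective
  let e : R ≃+* ψ.range := .ofBijective ψ.rangeRestrict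
    ⟨fun x y hxy ↦ hψ congr(($hxy).1), ψ.rangeRestrict_surjective⟩
  have he : (e : R →+* ψ.range).comp φ = Subring.inclusion hA := by
    ext a
    exact congr($hφ a)
  let i : Spec (CommRingCat.of R) ≅ Spec (CommRingCat.of ψ.range) :=
    Scheme.Spec.mapIso e.toCommRingCatIso.symm.op
  have hi : i.inv = Spec.map (CommRingCat.ofHom (e : R →+* ψ.range)) := rfl
  refine Set.Finite.of_finite_image (f := fun s ↦ i.inv ≫ s) ((h ψ.range hA hψR).subset ?_)
    fun s _ s' _ hs ↦ (cancel_epi _).mp hs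
  rintro _ ⟨s, hs, rfl⟩
  simp only [Set.mem_ofPred_eq, integralPoints] at hs ⊢
  rw [Category.assoc, hs, hi, ← Spec.map_comp, ← CommRingCat.ofHom_comp, he]

/-- Arithmetic hyperbolicity can be tested on a model over any finitely generated ring `A` that is
embedded in the field, not only over a subring of the field. -/
theorem IsArithmeticallyHyperbolic.of_isPullback {A K : Type u} [CommRing A]
    [Field K] [IsAlgClosed K] [CharZero K] (hA : Algebra.FiniteType ℤ A)
    {𝒳 Y : Scheme.{u}} {π : 𝒳 ⟶ Spec (CommRingCat.of A)} (hπ : IsFiniteTypeSeparated π)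
    {κ : A →+* K} (hκ : Function.Injective κ)
    {p : Y ⟶ Spec (CommRingCat.of K)} {ρ : Y ⟶ 𝒳}
    (hY : IsPullback ρ p π (Spec.map (CommRingCat.ofHom κ)))
    (hK : HasFinitelyManyIntegralPoints π κ) : IsArithmeticallyHyperbolic K p := by
  have hκR : Algebra.FiniteType ℤ κ.range :=
    hA.of_surjective κ.rangeRestrict.toIntAlgHom κ.rangeRestrict_surjective
  let e : A ≃+* κ.range := .ofBijective κ.rangeRestrict
    ⟨fun x y hxy ↦ hκ congr(($hxy).1), κ.rangeRestrict_surjective⟩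
  let i : Spec (CommRingCat.of A) ≅ Spec (CommRingCat.of κ.range) :=
    Scheme.Spec.mapIso e.toCommRingCatIso.symm.op
  have hi : i.inv = Spec.map (CommRingCat.ofHom (e : A →+* κ.range)) := rfl
  have hg : Spec.map (CommRingCat.ofHom κ) ≫ i.hom =
      Spec.map (CommRingCat.ofHom (algebraMap κ.range K)) := by
    rw [← Iso.eq_comp_inv, hi, ← Spec.map_comp, ← CommRingCat.ofHom_comp]
    rfl
  have hY' : IsPullback ρ p (π ≫ i.hom)
      (Spec.map (CommRingCat.ofHom (algebraMap κ.range K))) :=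
    hY.of_iso (Iso.refl _) (Iso.refl _) (Iso.refl _) i (by simp) (by simp) (by simp) (by simp [hg])
  have := hπ.locallyOfFiniteType
  have := hπ.quasiCompact
  have := hπ.isSeparated
  refine ⟨κ.range, hκR, 𝒳, π ≫ i.hom, ⟨inferInstance, inferInstance, inferInstance⟩,
    ⟨Over.isoMk hY'.isoPullback.symm (by simp)⟩, fun A' h hA' ↦ ?_⟩
  refine (hK A' hA' ((Subring.inclusion h).comp (e : A →+* κ.range)) A'.subtype
    A'.subtype_injective rfl).subset fun s hs ↦ ?_
  simp only [Set.mem_ofPred_eq, integralPoints] at hs ⊢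
  rw [CommRingCat.ofHom_comp, Spec.map_comp, ← hs, ← hi]
  simp

/-- The base change to `K` of a `k`-scheme `X` is also the base change of any model of `X`. -/
theorem isPullback_of_baseChange_iso {A k K : Type u} [CommRing A] [CommRing k] [CommRing K]
    [Algebra A k] [Algebra k K] {𝒳 X : Scheme.{u}} {π : 𝒳 ⟶ Spec (CommRingCat.of A)}
    {p : X ⟶ Spec (CommRingCat.of k)} (e : Over.mk (baseChangeHom A k π) ≅ Over.mk p) :
    IsPullback (pullback.fst _ _ ≫ e.inv.left ≫ pullback.fst _ _) (baseChangeHom k K p) π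
      (Spec.map (CommRingCat.ofHom ((algebraMap k K).comp (algebraMap A k)))) := by
  have h₁ : IsPullback (e.inv.left ≫ pullback.fst _ _) p π
      (Spec.map (CommRingCat.ofHom (algebraMap A k))) :=
    (IsPullback.of_hasPullback π _).of_iso ((Over.forget _).mapIso e) (Iso.refl _) (Iso.refl _)
      (Iso.refl _) (by simp [← Over.comp_left_assoc]) (by simpa using (Over.w e.hom).symm)
      (by simp) (by simp)
  have h₂ := (IsPullback.of_hasPullback p
    (Spec.map (CommRingCat.ofHom (algebraMap k K)))).paste_horiz h₁
  rwa [← Spec.map_comp, ← CommRingCat.ofHom_comp] at h₂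

theorem mainTheorem12 {k L K : Type u}
    [Field k] [IsAlgClosed k] [CharZero k]
    [Field L] [IsAlgClosed L] [CharZero L] [Algebra k L]
    [Uncountable L]
    [Field K] [IsAlgClosed K] [CharZero K] [Algebra k K]
    {X : Scheme.{u}} (p : X ⟶ Spec (CommRingCat.of k)) (hX : IsFiniteTypeSeparated p)
    (harith : IsArithmeticallyHyperbolic k p)
    (hgeom : IsGeometricallyHyperbolic L (baseChangeHom k L p)) :
    IsArithmeticallyHyperbolic K (baseChangeHom k K p) := by
  obtain ⟨A, hA, 𝒳, π, hπ, ⟨e⟩, hfin⟩ := harith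
  have := hπ.isSeparated
  have hk := hasFinitelyManyIntegralPoints_subtype hfin
  have hL : HasFinitelyManyIntegralPoints π ((algebraMap k L).comp A.subtype) :=
    hk.of_isGeometricallyHyperbolic (isPullback_of_baseChange_iso e) hgeom
  have hιL : Function.Injective ((algebraMap k L).comp A.subtype) :=
    (algebraMap k L).injective.comp A.subtype_injective
  have hιK : Function.Injective ((algebraMap k K).comp A.subtype) :=
    (algebraMap k K).injective.comp A.subtype_injective
  exact .of_isPullback hA hπ hιK (isPullback_of_baseChange_iso e) (hL.of_uncountable hιL hιK)
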